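/- Call a finite group $G$ admissible over a field $K$ if there is a finite Galois extension $L/K$ with $\mathrm{Gal}(L/K)\cong G$ and a division ring $D$ with center $K$ containing $L$ as a maximal subfield. Let $K$ be a complete discretely valued field with residue field $k$, and let $G$ be a finite group whose order is not divisible by $\mathrm{char}(k)$ (no condition if $\mathrm{char}(k)=0$). If $G$ is admissible over $K$, then every Sylow subgroup $P$ of $G$ has a normal series $P\supseteq P_1\supseteq P_2$ (with $P_1$ and $P_2$ both normal in $P$) such that (1) $P/P_1$ and $P_2$ are cyclic, and (2) $P_1/P_2$ is admissible over some finite extension of $k$. -/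

import Mathlib

universe u v

/-- `M` is a maximal subfield of the division `K`-algebra `D`: it is a field, and it is maximal
under inclusion among the subalgebras of `D` that are fields. (Any subfield of `D` that contains
such an `M` contains `K`, so only `K`-subalgebras have to be compared.) -/
def IsMaximalSubfield (K : Type u) (D : Type v) [Field K] [DivisionRing D] [Algebra K D]
    (M : Subalgebra K D) : Prop :=
  Maximal (fun N : Subalgebra K D => IsField N) M

/-- A finite field extension `L` of `K` is `K`-adequate if there is a division ring `D` with
center `K` that contains `L` as a maximal subfield. -/
def IsAdequate (K : Type u) (L : Type u) [Field K] [Field L] [Algebra K L] : Prop :=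
  FiniteDimensional K L ∧
    ∃ (D : Type u) (_ : DivisionRing D) (_ : Algebra K D) (f : L →ₐ[K] D),
      Algebra.IsCentral K D ∧ IsMaximalSubfield K D f.range

/-- A group `G` is `K`-admissible if it is the Galois group of a (finite) Galois
extension `L` of `K` that is `K`-adequate. -/
def IsAdmissible (K : Type u) (G : Type v) [Field K] [Group G] : Prop :=
  ∃ (L : Type u) (_ : Field L) (_ : Algebra K L),
    IsGalois K L ∧ Nonempty (Gal(L/K) ≃* G) ∧ IsAdequate K L

/-! Let `D` be a division ring with centre `K` and maximal subfield `L` realising `G`. `L` is its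
own centralizer, so Skolem–Noether presents `D` as a crossed product, finite over `K`. The
centralizer of `L^P` in `D` is then a crossed product of `L` with `P`, and only this division ring
is used afterwards. Completeness of `K` makes the valuation of the norm to `K` a valuation `w` on it
(`exists_valuation_eq_norm`).

Let `y g` induce `g` on `L`. The value of `y g` modulo the values of `L` is a homomorphism on `P`
into a quotient of an infinite cyclic group; its kernel is `P₁`, so `P/P₁` is cyclic. `P₂` is the
part of `P₁` acting trivially on the residue field of `L`. Since the order of `P` is a unit in the
residue field, ramification is tame and inertia embeds in the multiplicative group of a field, so
`P₂` is cyclic.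

Let `R` be the residue division ring of `w` and `E` its centre. Tameness prevents cancellation
between the components of a sum `∑ φ(a g) y g` (`w_component_le`), so `R` has the residues of units
`z g`, `g ∈ P₁`, as a basis over the residue field of `L`. The centralizer `M` of that residue field
is spanned by the `z g` with `g ∈ P₂`; as `P₂` is cyclic, `M` is commutative, hence a maximal
subfield of `R`. Conjugation by the `z g` makes `P₁` act on `M` with kernel `P₂` and fixed field
`E`, so `M/E` realises `P₁/P₂` (`ValuedCrossedProduct.isAdmissible`). Lifting independent residues
gives `[E : k] ≤ [D : K]`. -/

/-! ### Extending the valuation to a division algebra by the norm -/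

open Polynomial in
theorem Algebra.norm_eq_pow_of_algHom {K F D : Type*} [Field K] [Field F] [Algebra K F]
    [Ring D] [Algebra K D] [FiniteDimensional K D] (φ : F →ₐ[K] D) :
    ∃ n : ℕ, (Nontrivial D → n ≠ 0) ∧ ∀ a : F, Algebra.norm K (φ a) = Algebra.norm K a ^ n := by
  -- Left multiplication by `φ a` is the scalar `a` on the `F`-space `D`, so its determinant over
  -- `K` is the norm of `a ^ dim_F D`.
  let : Module F D := Module.compHom D (φ : F →+* D)
  have hsmul : ∀ (a : F) (d : D), a • d = φ a * d := fun _ _ => rfl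
  have : IsScalarTower K F D := ⟨fun c a d => by
    rw [hsmul, hsmul, map_smul, smul_mul_assoc]⟩
  have : Module.Finite F D := Module.Finite.of_restrictScalars_finite K F D
  refine ⟨Module.finrank F D, fun _ => Module.finrank_pos.ne', fun a => ?_⟩
  have h := LinearMap.det_restrictScalars (R := K) (S := F) (A := D)
    (f := a • LinearMap.id)
  rw [LinearMap.det_smul, LinearMap.det_id, mul_one, map_pow] at h
  rw [← h, Algebra.norm_apply]
  congr 1

/-- Both sides compare the constant coefficient of the minimal polynomial with 1: the spectral norm
is a root of its absolute value, the norm of `a` a power of it up to sign. -/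
theorem spectralNorm_le_one_iff {K F : Type*} [NontriviallyNormedField K]
    [IsUltrametricDist K] [CompleteSpace K] [Field F] [Algebra K F] [FiniteDimensional K F]
    (a : F) : spectralNorm K F a ≤ 1 ↔ ‖Algebra.norm K a‖ ≤ 1 := by
  have hint : IsIntegral K a := Algebra.IsIntegral.isIntegral a
  have h1 : ‖Algebra.norm K (IntermediateField.AdjoinSimple.gen K a)‖ =
      ‖(minpoly K a).coeff 0‖ := by
    have h := Algebra.PowerBasis.norm_gen_eq_coeff_zero_minpoly
      (IntermediateField.adjoin.powerBasis hint)
    rw [IntermediateField.adjoin.powerBasis_gen, IntermediateField.minpoly_gen] at h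
    rw [h]
    simp
  have hpos : 0 < (minpoly K a).natDegree := minpoly.natDegree_pos hint
  rw [spectralNorm.spectralNorm_eq_norm_coeff_zero_rpow, Algebra.norm_eq_norm_adjoin, norm_pow, h1,
    pow_le_one_iff_of_nonneg (norm_nonneg _) Module.finrank_pos.ne']
  constructor
  · intro h
    by_contra hc
    exact absurd h (not_le.mpr (Real.one_lt_rpow (not_le.mp hc) (by positivity)))
  · intro h
    exact Real.rpow_le_one (norm_nonneg _) h (by positivity)

open Polynomial in
/-- The embedding of the simple extension generated by an element of a ring. -/
noncomputable def simpleExtensionHom {K D : Type*} [Field K] [Ring D] [Algebra K D] (x : D) :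
    AdjoinRoot (minpoly K x) →ₐ[K] D :=
  Ideal.Quotient.liftₐ (Ideal.span {minpoly K x}) (aeval x) (by
    intro a ha
    obtain ⟨b, rfl⟩ := Ideal.mem_span_singleton.mp ha
    simp)

theorem simpleExtensionHom_root {K D : Type*} [Field K] [Ring D] [Algebra K D] (x : D) :
    simpleExtensionHom (K := K) x (AdjoinRoot.root _) = x := by
  have := Ideal.Quotient.liftₐ_apply (Ideal.span {minpoly K x}) (Polynomial.aeval x) (by
    intro a ha
    obtain ⟨b, rfl⟩ := Ideal.mem_span_singleton.mp ha
    simp) (AdjoinRoot.root _)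
  refine this.trans ?_
  exact Polynomial.aeval_X x

/-- Only the commutative field `K(x)` is involved: there the norm from `D` is a power of the field
norm, and the spectral norm is ultrametric. -/
theorem norm_algebraNorm_one_add_le {K D : Type*} [NontriviallyNormedField K]
    [IsUltrametricDist K] [CompleteSpace K] [DivisionRing D] [Algebra K D] [FiniteDimensional K D]
    {x : D} (hx : ‖Algebra.norm K x‖ ≤ 1) : ‖Algebra.norm K (1 + x)‖ ≤ 1 := by
  have hint : IsIntegral K x := Algebra.IsIntegral.isIntegral x
  have : Fact (Irreducible (minpoly K x)) := ⟨minpoly.irreducible hint⟩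
  have : FiniteDimensional K (AdjoinRoot (minpoly K x)) :=
    (AdjoinRoot.powerBasis (minpoly.ne_zero hint)).finite
  obtain ⟨n, hn, h⟩ := Algebra.norm_eq_pow_of_algHom (simpleExtensionHom (K := K) x)
  have hn := hn inferInstance
  have hroot := simpleExtensionHom_root (K := K) x
  set a := AdjoinRoot.root (minpoly K x)
  have h1 : 1 + x = simpleExtensionHom (K := K) x (1 + a) := by rw [map_add, map_one, hroot]
  rw [h1, h, norm_pow, pow_le_one_iff_of_nonneg (norm_nonneg _) hn,
    ← spectralNorm_le_one_iff]
  rw [← hroot, h, norm_pow, pow_le_one_iff_of_nonneg (norm_nonneg _) hn,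
    ← spectralNorm_le_one_iff] at hx
  exact (isNonarchimedean_spectralNorm 1 a).trans (max_le spectralNorm_one.le hx)

/-- A complete discrete valuation composed with the algebra norm of a finite-dimensional division
algebra is a valuation. -/
theorem exists_valuation_eq_norm (K : Type*) [Field K] [Valued K (WithZero (Multiplicative ℤ))]
    [(Valued.v : Valuation K (WithZero (Multiplicative ℤ))).IsRankOneDiscrete] [CompleteSpace K]
    (D : Type*) [DivisionRing D] [Algebra K D] [FiniteDimensional K D] :
    ∃ w : Valuation D (WithZero (Multiplicative ℤ)), ∀ x, w x = Valued.v (Algebra.norm K x) := by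
  obtain ⟨hr⟩ : Nonempty (Valued.v : Valuation K (WithZero (Multiplicative ℤ))).RankOne := by
    rw [Valuation.nonempty_rankOne_iff_mulArchimedean]
    infer_instance
  let := Valued.toNontriviallyNormedField (L := K) (Γ₀ := WithZero (Multiplicative ℤ))
  have key : ∀ x : D, (Valued.v (Algebra.norm K x) : WithZero (Multiplicative ℤ)) ≤ 1 →
      (Valued.v (Algebra.norm K (1 + x)) : WithZero (Multiplicative ℤ)) ≤ 1 := by
    intro x hx
    rw [← Valued.toNormedField.norm_le_one_iff] at hx ⊢
    exact norm_algebraNorm_one_add_le hx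
  have h0 : (Valued.v (Algebra.norm K (0 : D)) : WithZero (Multiplicative ℤ)) = 0 := by
    rw [Algebra.norm_zero, map_zero]
  have hpos : ∀ x y : D, (Valued.v (Algebra.norm K x) : WithZero (Multiplicative ℤ)) ≤
      Valued.v (Algebra.norm K y) →
      (Valued.v (Algebra.norm K (x + y)) : WithZero (Multiplicative ℤ)) ≤
        Valued.v (Algebra.norm K y) := by
    intro x y h
    by_cases hy : y = 0
    · subst hy
      rw [add_zero]
      exact h
    -- Multiplicativity reduces the ultrametric inequality to the case of `1 + x`.
    · have e : x + y = y * (1 + y⁻¹ * x) := by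
        rw [mul_add, mul_one, mul_inv_cancel_left₀ hy, add_comm]
      rw [e, map_mul, map_mul]
      refine mul_le_of_le_one_right' (key _ ?_)
      have e2 : (Valued.v (Algebra.norm K y) : WithZero (Multiplicative ℤ)) *
          Valued.v (Algebra.norm K (y⁻¹ * x)) = Valued.v (Algebra.norm K x) := by
        rw [← map_mul, ← map_mul, mul_inv_cancel_left₀ hy]
      have hv : 0 < (Valued.v (Algebra.norm K y) : WithZero (Multiplicative ℤ)) := by
        rw [zero_lt_iff, Valuation.ne_zero_iff]
        intro hc
        have := congrArg (· * Algebra.norm K y⁻¹) hc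
        simp only [zero_mul, ← map_mul, mul_inv_cancel₀ hy, map_one] at this
        exact one_ne_zero this
      rw [← e2] at h
      exact (mul_le_iff_le_one_right hv).mp h
  refine ⟨{ toFun := fun x => Valued.v (Algebra.norm K x)
            map_zero' := h0
            map_one' := by rw [map_one, map_one]
            map_mul' := fun x y => by rw [map_mul, map_mul]
            map_add_le_max' := fun x y => ?_ }, fun x => rfl⟩
  rcases le_total (Valued.v (Algebra.norm K x) : WithZero (Multiplicative ℤ))
    (Valued.v (Algebra.norm K y)) with h | h
  · exact (hpos x y h).trans (le_max_right _ _)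
  · rw [add_comm]
    exact (hpos y x h).trans (le_max_left _ _)

/-! ### Galois subfields of division rings -/

/-- The idempotents of `L ⊗ L`, one for each `g`, project `D` as an `L`-bimodule onto the part where
right multiplication by `a` is left multiplication by `g • a`. Trace-dual bases write them
explicitly. -/
theorem exists_sum_eigencomponents {P L D : Type*} [Group P] [Fintype P] [Field L]
    [MulSemiringAction P L] [FaithfulSMul P L] [Ring D] (φ : L →+* D) (d : D)
    (hd : ∀ a : L, (∀ g : P, g • a = a) → d * φ a = φ a * d) :
    ∃ c : P → D, d = ∑ g, c g ∧ ∀ g a, c g * φ a = φ (g • a) * c g := by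
  classical
  let K := FixedPoints.subfield P L
  have hd' : ∀ c : K, d * φ c = φ c * d := fun c => hd c c.2
  have : IsGaloisGroup P K L :=
    { faithful := inferInstance
      commutes := inferInstance
      isInvariant := ⟨fun b h => ⟨⟨b, h⟩, rfl⟩⟩ }
  have : FiniteDimensional K L := IsGaloisGroup.finiteDimensional P K L
  have : IsGalois K L := IsGaloisGroup.isGalois P K L
  have htr : ∀ x : L, ((Algebra.trace K L x : K) : L) = ∑ g : P, g • x := by
    intro x
    refine (trace_eq_sum_automorphisms (K := K) x).trans ?_
    exact (Equiv.sum_comp (IsGaloisGroup.mulEquivAlgEquiv P K L).toEquiv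
      (fun s : Gal(L/K) => s x)).symm
  let b := Module.finBasis K L
  let b' := b.traceDual
  have hexp : ∀ x : L, x = ∑ i, Algebra.trace K L (x * b i) • b' i := fun x => by
    conv_lhs => rw [← b'.sum_repr x]
    simp [b', Algebra.traceForm_apply]
  have hexp' : ∀ x : L, x = ∑ i, Algebra.trace K L (x * b' i) • b i := fun x => by
    conv_lhs => rw [← b.sum_repr x]
    refine Finset.sum_congr rfl fun i _ => ?_
    congr 1
    have := b'.traceDual_repr_apply x i
    rw [Module.Basis.traceDual_traceDual] at this
    rw [this, Algebra.traceForm_apply]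
  refine ⟨fun g => ∑ i, φ (g • b i) * d * φ (b' i), ?_, fun g a => ?_⟩
  · rw [Finset.sum_comm]
    have h1 : ∀ i, ∑ g : P, φ (g • b i) * d * φ (b' i) =
        d * φ ((Algebra.trace K L (b i) : K) • b' i) := by
      intro i
      rw [← Finset.sum_mul, ← Finset.sum_mul, ← map_sum, ← htr, ← hd', mul_assoc, ← map_mul]
      rfl
    simp_rw [h1]
    rw [← Finset.mul_sum, ← map_sum]
    have := hexp 1
    simp only [one_mul] at this
    rw [← this, map_one, mul_one]
  -- `t` is the matrix of multiplication by `a` in the dual basis; its transpose describes it in the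
  -- basis `b`, and entries in `K` pass through `d`.
  · obtain ⟨t, ht⟩ : ∃ t : _ → _ → K, ∀ i j, t i j = Algebra.trace K L (b' i * a * b j) :=
      ⟨_, fun _ _ => rfl⟩
    have h1 : ∀ i, b' i * a = ∑ j, (t i j : L) * b' j := fun i => by
      simp_rw [ht]
      exact hexp _
    have h2 : ∀ j, g • a * g • b j = ∑ i, g • b i * (t i j : L) := by
      intro j
      rw [← smul_mul', hexp' (a * b j), Finset.smul_sum]
      refine Finset.sum_congr rfl fun i _ => ?_
      rw [smul_comm, ht, show b' i * a * b j = a * b j * b' i by ring, mul_comm (g • b i)]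
      rfl
    rw [Finset.sum_mul, Finset.mul_sum]
    have e1 : ∀ i, φ (g • b i) * d * φ (b' i) * φ a =
        ∑ j, φ (g • b i * (t i j : L)) * d * φ (b' j) := by
      intro i
      rw [mul_assoc, ← map_mul, h1, map_sum, Finset.mul_sum]
      refine Finset.sum_congr rfl fun j _ => ?_
      rw [map_mul, map_mul]
      simp only [mul_assoc]
      rw [← mul_assoc d, hd', mul_assoc]
    have e2 : ∀ j, φ (g • a) * (φ (g • b j) * d * φ (b' j)) =
        ∑ i, φ (g • b i * (t i j : L)) * d * φ (b' j) := by
      intro j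
      rw [← Finset.sum_mul, ← Finset.sum_mul, ← map_sum, ← h2, map_mul]
      simp only [mul_assoc]
    simp_rw [e1, e2]
    exact Finset.sum_comm

theorem Subalgebra.inv_mem_centralizer {K D : Type*} [Field K] [DivisionRing D] [Algebra K D]
    {s : Set D} {x : D} (hx : x ∈ Subalgebra.centralizer K s) :
    x⁻¹ ∈ Subalgebra.centralizer K s := by
  rw [Subalgebra.mem_centralizer_iff] at hx ⊢
  intro g hg
  exact (Commute.inv_right₀ (hx g hg : Commute g x))

/-- The double centralizer of `M ∪ {x}` is commutative and closed under inverses, so it is a field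
containing `M` and `x`; no finiteness of `D` is needed. -/
theorem IsMaximalSubfield.mem_of_commute {K : Type u} {D : Type v} [Field K] [DivisionRing D]
    [Algebra K D] {M : Subalgebra K D} (hM : IsMaximalSubfield K D M) {x : D}
    (hx : ∀ a ∈ M, x * a = a * x) : x ∈ M := by
  let S : Set D := insert x M
  have hMcomm : ∀ a ∈ M, ∀ b ∈ M, a * b = b * a := fun a ha b hb =>
    congrArg Subtype.val (hM.1.mul_comm ⟨a, ha⟩ ⟨b, hb⟩)
  have hS : ∀ a ∈ S, ∀ b ∈ S, a * b = b * a := by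
    rintro a (rfl | ha) b (rfl | hb)
    · rfl
    · exact hx b hb
    · exact (hx a ha).symm
    · exact hMcomm a ha b hb
  let C := Subalgebra.centralizer K S
  let N := Subalgebra.centralizer K (C : Set D)
  have hSC : ∀ a ∈ S, a ∈ C := fun a ha => Subalgebra.mem_centralizer_iff K |>.mpr
    fun g hg => hS g hg a ha
  have hSN : ∀ a ∈ S, a ∈ N := fun a ha => Subalgebra.mem_centralizer_iff K |>.mpr
    fun g hg => ((Subalgebra.mem_centralizer_iff K).mp hg a ha).symm
  have hNC : ∀ a ∈ N, a ∈ C := fun a ha => Subalgebra.mem_centralizer_iff K |>.mpr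
    fun g hg => (Subalgebra.mem_centralizer_iff K).mp ha g (hSC g hg)
  have hN : IsField N :=
    { exists_pair_ne := ⟨0, 1, zero_ne_one⟩
      mul_comm := fun a b => Subtype.ext
        ((Subalgebra.mem_centralizer_iff K).mp b.2 a (hNC a a.2))
      mul_inv_cancel := fun {a} ha => ⟨⟨(a : D)⁻¹, Subalgebra.inv_mem_centralizer a.2⟩,
        Subtype.ext (mul_inv_cancel₀ fun h => ha (Subtype.ext h))⟩ }
  exact hM.2 hN (fun a ha => hSN a (Set.mem_insert_of_mem _ ha)) (hSN x (Set.mem_insert _ _))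

/-- The Skolem-Noether property for a Galois subfield which is its own centralizer. -/
theorem exists_ne_zero_mul_eq {K L D : Type*} [Field K] [Field L] [Algebra K L]
    [FiniteDimensional K L] [IsGalois K L] [DivisionRing D] [Algebra K D] [Algebra.IsCentral K D]
    (φ : L →ₐ[K] D) (g : Gal(L/K)) :
    ∃ y : D, y ≠ 0 ∧ ∀ a, y * φ a = φ (g a) * y := by
  let H : Subgroup Gal(L/K) :=
    { carrier := {g | ∃ y : D, y ≠ 0 ∧ ∀ a, y * φ a = φ (g a) * y}
      one_mem' := ⟨1, one_ne_zero, fun a => by simp⟩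
      mul_mem' := by
        rintro g h ⟨y, hy, hya⟩ ⟨z, hz, hza⟩
        exact ⟨y * z, mul_ne_zero hy hz, fun a => by
          rw [mul_assoc, hza, ← mul_assoc, hya, mul_assoc]; rfl⟩
      inv_mem' := by
        rintro g ⟨y, hy, hya⟩
        refine ⟨y⁻¹, inv_ne_zero hy, fun a => ?_⟩
        have := hya (g⁻¹ a)
        rw [show g (g⁻¹ a) = a from AlgEquiv.apply_symm_apply g a] at this
        rw [inv_mul_eq_iff_eq_mul₀ hy, ← mul_assoc, this, mul_assoc, mul_inv_cancel₀ hy, mul_one] }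
  suffices H = ⊤ by
    have hg : g ∈ H := this ▸ Subgroup.mem_top g
    exact hg
  -- A nonzero `g`-eigencomponent of any `d` shows `g ∈ H`. So an element fixed by `H` commutes with
  -- every component of every `d`, hence is central; Galois theory then gives `H = ⊤`.
  have hbot : IntermediateField.fixedField H = ⊥ := by
    rw [eq_bot_iff]
    intro a ha
    rw [IntermediateField.mem_fixedField_iff] at ha
    have hcen : φ a ∈ Subalgebra.center K D := by
      rw [Subalgebra.mem_center_iff]
      intro d
      obtain ⟨c, hdc, hc⟩ := exists_sum_eigencomponents (P := Gal(L/K)) (φ : L →+* D) d (by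
        intro x hx
        obtain ⟨k, rfl⟩ := (IsGalois.mem_bot_iff_fixed x).mpr hx
        have e : (φ : L →+* D) (algebraMap K L k) = algebraMap K D k := φ.commutes k
        exact e ▸ (Algebra.commutes k d).symm)
      rw [hdc, Finset.sum_mul, Finset.mul_sum]
      refine Finset.sum_congr rfl fun g _ => ?_
      by_cases h0 : c g = 0
      · simp [h0]
      · have h1 := hc g a
        have h2 : g • a = a := ha g ⟨c g, h0, hc g⟩
        rw [h2] at h1
        exact h1
    rw [Algebra.IsCentral.center_eq_bot, Algebra.mem_bot] at hcen
    obtain ⟨k, hk⟩ := hcen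
    rw [IntermediateField.mem_bot]
    exact ⟨k, (φ : L →+* D).injective ((φ.commutes k).trans hk)⟩
  rw [← IntermediateField.fixingSubgroup_fixedField H, hbot, IntermediateField.fixingSubgroup_bot]

/-- Two elements inducing the same automorphism of a self-centralizing subfield differ by an
element of the subfield. -/
theorem exists_eq_mul_of_mul_eq {P L D : Type*} [Group P] [Field L] [MulSemiringAction P L]
    [DivisionRing D] (φ : L →+* D) (hC : ∀ x, (∀ a, x * φ a = φ a * x) → ∃ a, φ a = x)
    {g : P} {u v : D} (hu : ∀ a, u * φ a = φ (g • a) * u)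
    (hv : ∀ a, v * φ a = φ (g • a) * v) (hv0 : v ≠ 0) : ∃ c, u = φ c * v := by
  obtain ⟨c, hc⟩ := hC (u * v⁻¹) (fun a => by
    have h1 : v⁻¹ * φ a = φ (g⁻¹ • a) * v⁻¹ := by
      rw [inv_mul_eq_iff_eq_mul₀ hv0, ← mul_assoc, hv, smul_inv_smul, mul_assoc,
        mul_inv_cancel₀ hv0, mul_one]
    rw [mul_assoc, h1, ← mul_assoc, hu, smul_inv_smul, mul_assoc])
  exact ⟨c, by rw [hc, inv_mul_cancel_right₀ hv0]⟩

theorem exists_sum_mul {P L D : Type*} [Group P] [Fintype P] [Field L]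
    [MulSemiringAction P L] [FaithfulSMul P L] [DivisionRing D] (φ : L →+* D)
    (hC : ∀ x, (∀ a, x * φ a = φ a * x) → ∃ a, φ a = x) (y : P → D) (hy0 : ∀ g, y g ≠ 0)
    (hy : ∀ g a, y g * φ a = φ (g • a) * y g) (d : D)
    (hd : ∀ a : L, (∀ g : P, g • a = a) → d * φ a = φ a * d) :
    ∃ a : P → L, d = ∑ g, φ (a g) * y g := by
  obtain ⟨c, hdc, hc⟩ := exists_sum_eigencomponents φ d hd
  choose a ha using fun g => exists_eq_mul_of_mul_eq φ hC (hc g) (hy g) (hy0 g)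
  exact ⟨a, hdc.trans (Finset.sum_congr rfl fun g _ => ha g)⟩

/-! ### Residue rings of valuations -/

/-- A map reducing the elements of valuation at most one of a ring modulo those of valuation
less than one. -/
structure ResidueMap {D Γ : Type*} [Ring D] [LinearOrderedCommGroupWithZero Γ]
    (w : Valuation D Γ) (R : Type*) [Ring R] where
  /-- The reduction; its values outside the valuation ring are irrelevant. -/
  res : D → R
  res_one : res 1 = 1
  res_add : ∀ {x y}, w x ≤ 1 → w y ≤ 1 → res (x + y) = res x + res y
  res_mul : ∀ {x y}, w x ≤ 1 → w y ≤ 1 → res (x * y) = res x * res y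
  res_eq_zero : ∀ {x}, w x ≤ 1 → (res x = 0 ↔ w x < 1)
  exists_res : ∀ t, ∃ x, w x ≤ 1 ∧ res x = t

/-- The ideal of elements of valuation less than one in the ring of integers of a valuation. -/
def Valuation.residueIdeal {D Γ : Type*} [Ring D] [LinearOrderedCommGroupWithZero Γ]
    (w : Valuation D Γ) : Ideal w.integer where
  carrier := {x | w x < 1}
  add_mem' := fun hx hy => w.map_add_lt hx hy
  zero_mem' := by simp
  smul_mem' := fun c x hx => by
    change w (c * x : D) < 1
    rw [map_mul]
    exact mul_lt_one_of_nonneg_of_lt_one_right c.2 zero_le hx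

instance Valuation.residueIdeal_isTwoSided {D Γ : Type*} [Ring D]
    [LinearOrderedCommGroupWithZero Γ] (w : Valuation D Γ) : w.residueIdeal.IsTwoSided where
  mul_mem_of_left := fun {x} c hx => by
    change w (x * c : D) < 1
    rw [map_mul]
    exact mul_lt_one_of_nonneg_of_lt_one_left zero_le hx c.2

theorem Valuation.exists_residueMap {D : Type u} {Γ : Type*} [DivisionRing D]
    [LinearOrderedCommGroupWithZero Γ] (w : Valuation D Γ) :
    ∃ (R : Type u) (_ : DivisionRing R), Nonempty (ResidueMap w R) := by
  classical
  let q := Ideal.Quotient.mk w.residueIdeal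
  have hq : ∀ x : w.integer, q x = 0 ↔ w x < 1 := fun x => Ideal.Quotient.eq_zero_iff_mem
  have : Nontrivial (w.integer ⧸ w.residueIdeal) := ⟨⟨q 1, 0, fun h => by
    have := (hq 1).mp h
    simp at this⟩⟩
  let inst : DivisionRing (w.integer ⧸ w.residueIdeal) := DivisionRing.ofIsUnitOrEqZero (by
    intro t
    obtain ⟨x, rfl⟩ := Ideal.Quotient.mk_surjective t
    by_cases hx : w (x : D) < 1
    · exact Or.inr ((hq x).mpr hx)
    · have h1 : w (x : D) = 1 := le_antisymm x.2 (not_lt.mp hx)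
      have h0 : (x : D) ≠ 0 := fun h => by simp [h] at h1
      have hinv : w (x : D)⁻¹ ≤ 1 := by rw [map_inv₀, h1, inv_one]
      let x' : w.integer := ⟨(x : D)⁻¹, hinv⟩
      have e1 : x * x' = 1 := Subtype.ext (mul_inv_cancel₀ h0)
      have e2 : x' * x = 1 := Subtype.ext (inv_mul_cancel₀ h0)
      exact Or.inl ⟨⟨q x, q x', by rw [← map_mul, e1, map_one], by rw [← map_mul, e2, map_one]⟩,
        rfl⟩)
  let res : D → w.integer ⧸ w.residueIdeal := fun x => if h : w x ≤ 1 then q ⟨x, h⟩ else 0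
  have hres : ∀ {x} (h : w x ≤ 1), res x = q ⟨x, h⟩ := fun h => dif_pos h
  refine ⟨w.integer ⧸ w.residueIdeal, inst, ⟨⟨res, ?_, ?_, ?_, ?_, ?_⟩⟩⟩
  · rw [hres w.map_one.le]
    exact map_one q
  · intro x y hx hy
    rw [hres hx, hres hy, hres (w.integer.add_mem hx hy)]
    exact map_add q ⟨x, hx⟩ ⟨y, hy⟩
  · intro x y hx hy
    rw [hres hx, hres hy, hres (w.integer.mul_mem hx hy)]
    exact map_mul q ⟨x, hx⟩ ⟨y, hy⟩
  · intro x hx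
    rw [hres hx]
    exact hq _
  · intro t
    obtain ⟨x, rfl⟩ := Ideal.Quotient.mk_surjective t
    exact ⟨x, x.2, hres x.2⟩

namespace ResidueMap

variable {D Γ R : Type*} [Ring D] [LinearOrderedCommGroupWithZero Γ] {w : Valuation D Γ} [Ring R]
  (r : ResidueMap w R)

theorem res_zero : r.res 0 = 0 := (r.res_eq_zero (by simp)).mpr (by simp)

theorem res_sum {ι : Type*} (s : Finset ι) (f : ι → D) (hf : ∀ i ∈ s, w (f i) ≤ 1) :
    r.res (∑ i ∈ s, f i) = ∑ i ∈ s, r.res (f i) := by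
  classical
  induction s using Finset.induction_on with
  | empty => simp [r.res_zero]
  | insert i s hi ih =>
    rw [Finset.sum_insert hi, Finset.sum_insert hi, r.res_add (hf i (by simp)),
      ih fun j hj => hf j (by simp [hj])]
    exact w.map_sum_le fun j hj => hf j (by simp [hj])

theorem res_neg {x : D} (hx : w x ≤ 1) : r.res (-x) = -r.res x := by
  have h := r.res_add hx (y := -x) (by rwa [w.map_neg])
  rw [add_neg_cancel, r.res_zero] at h
  exact (neg_eq_of_add_eq_zero_right h.symm).symm

theorem res_sub {x y : D} (hx : w x ≤ 1) (hy : w y ≤ 1) :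
    r.res (x - y) = r.res x - r.res y := by
  rw [sub_eq_add_neg, r.res_add hx (by rwa [w.map_neg]), r.res_neg hy, sub_eq_add_neg]

theorem res_ne_zero {x : D} (hx : w x = 1) : r.res x ≠ 0 := fun h =>
  ((r.res_eq_zero hx.le).mp h).ne hx

theorem eq_one_of_res_ne_zero {x : D} (hx : w x ≤ 1) (h : r.res x ≠ 0) : w x = 1 :=
  le_antisymm hx (not_lt.mp fun h' => h ((r.res_eq_zero hx).mpr h'))

end ResidueMap

/-! ### Tame ramification in a valued crossed product -/

/-- A valued division ring presented as a crossed product of a subfield with a finite group whose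
order is a unit in the residue ring. -/
structure ValuedCrossedProduct (G L D : Type*) [Group G] [Fintype G] [Field L]
    [MulSemiringAction G L] [DivisionRing D] where
  /-- The valuation. -/
  w : Valuation D (WithZero (Multiplicative ℤ))
  /-- The embedding of the subfield. -/
  φ : L →+* D
  /-- The elements inducing the automorphisms of the subfield. -/
  y : G → D
  y_ne_zero : ∀ g, y g ≠ 0
  y_mul : ∀ g a, y g * φ a = φ (g • a) * y g
  exists_sum : ∀ d, ∃ a : G → L, d = ∑ g, φ (a g) * y g
  exists_of_commute : ∀ x, (∀ a, x * φ a = φ a * x) → ∃ a, φ a = x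
  w_card : w (Nat.card G : D) = 1

namespace ValuedCrossedProduct

variable {G L D : Type*} [Group G] [Fintype G] [Field L] [MulSemiringAction G L]
  [DivisionRing D] (C : ValuedCrossedProduct G L D)

theorem w_φ_ne_zero {a : L} (ha : a ≠ 0) : C.w (C.φ a) ≠ 0 :=
  (Valuation.ne_zero_iff _).mpr ((map_ne_zero C.φ).mpr ha)

/-- Take values in `y g * φ a = φ (g • a) * y g`: the value group is commutative, so conjugation
preserves `w`. -/
theorem w_smul (g : G) (a : L) : C.w (C.φ (g • a)) = C.w (C.φ a) := by
  have h := congrArg C.w (C.y_mul g a)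
  rw [map_mul, map_mul, mul_comm] at h
  exact (mul_right_cancel₀ ((Valuation.ne_zero_iff _).mpr (C.y_ne_zero g)) h).symm

theorem exists_eq_mul {g : G} {u v : D} (hu : ∀ a, u * C.φ a = C.φ (g • a) * u)
    (hv : ∀ a, v * C.φ a = C.φ (g • a) * v) (hv0 : v ≠ 0) : ∃ c, u = C.φ c * v :=
  exists_eq_mul_of_mul_eq C.φ C.exists_of_commute hu hv hv0

theorem exists_y_mul_y (g h : G) : ∃ c, c ≠ 0 ∧ C.y g * C.y h = C.φ c * C.y (g * h) := by
  obtain ⟨c, hc⟩ := C.exists_eq_mul (g := g * h) (u := C.y g * C.y h) (v := C.y (g * h))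
    (fun a => by rw [mul_assoc, C.y_mul, ← mul_assoc, C.y_mul, mul_smul, mul_assoc])
    (C.y_mul _) (C.y_ne_zero _)
  refine ⟨c, ?_, hc⟩
  rintro rfl
  rw [map_zero, zero_mul] at hc
  exact mul_ne_zero (C.y_ne_zero g) (C.y_ne_zero h) hc

theorem w_natCast_le (n : ℕ) : C.w (n : D) ≤ 1 := by
  induction n with
  | zero => simp
  | succ n ih =>
    rw [Nat.cast_succ]
    exact C.w.map_add_le ih C.w.map_one.le

theorem w_natCast_of_dvd {n : ℕ} (h : n ∣ Nat.card G) : C.w (n : D) = 1 := by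
  obtain ⟨m, hm⟩ := h
  have h1 := C.w_card
  rw [hm, Nat.cast_mul, map_mul] at h1
  refine le_antisymm (C.w_natCast_le n) ?_
  rw [← h1]
  exact mul_le_of_le_one_right' (C.w_natCast_le m)

/-- Wild ramification groups are trivial. -/
theorem exists_w_smul_sub [FaithfulSMul G L] {g : G} (hg : g ≠ 1) :
    ∃ x : L, x ≠ 0 ∧ C.w (C.φ (g • x - x)) = C.w (C.φ x) := by
  by_contra! hcon
  have hlt : ∀ x : L, x ≠ 0 → C.w (C.φ (g • x - x)) < C.w (C.φ x) := fun x hx =>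
    lt_of_le_of_ne (by
      rw [map_sub]
      exact (C.w.map_sub _ _).trans (max_le (C.w_smul g x).le le_rfl)) (hcon x hx)
  have hpow : ∀ (j : ℕ) (x : L), x ≠ 0 → C.w (C.φ (g ^ j • x - x)) < C.w (C.φ x) := by
    intro j x hx
    induction j with
    | zero => simpa [zero_lt_iff] using hx
    | succ j ih =>
      have e : g ^ (j + 1) • x - x = g ^ j • (g • x - x) + (g ^ j • x - x) := by
        rw [pow_succ, mul_smul, smul_sub]
        ring
      rw [e, map_add]
      refine C.w.map_add_lt ?_ ih
      rw [C.w_smul]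
      exact hlt x hx
  obtain ⟨z, hz⟩ : ∃ z : L, g • z ≠ z := by
    by_contra! h
    exact hg (FaithfulSMul.eq_of_smul_eq_smul (α := L) fun a => by rw [h, one_smul])
  -- The sum of the translates of `x` under the powers of `g` telescopes to 0. So `orderOf g * x` is
  -- minus a sum of terms of value below that of `x`, although `orderOf g` has value 1.
  set x := g • z - z with hxdef
  have hx : x ≠ 0 := sub_ne_zero.mpr hz
  have htel : ∑ j ∈ Finset.range (orderOf g), g ^ j • x = 0 := by
    have : ∀ j, g ^ j • x = g ^ (j + 1) • z - g ^ j • z := fun j => by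
      rw [hxdef, smul_sub, pow_succ, mul_smul]
    simp_rw [this]
    rw [Finset.sum_range_sub (fun j => g ^ j • z), pow_orderOf_eq_one, pow_zero, sub_self]
  have hsum : (orderOf g : L) * x = -∑ j ∈ Finset.range (orderOf g), (g ^ j • x - x) := by
    rw [Finset.sum_sub_distrib, htel]
    simp
  have h1 : C.w (C.φ ((orderOf g : L) * x)) = C.w (C.φ x) := by
    rw [map_mul, map_mul, map_natCast, C.w_natCast_of_dvd (orderOf_dvd_natCard g), one_mul]
  rw [hsum, map_neg, Valuation.map_neg, map_sum] at h1
  refine (C.w.map_sum_lt (C.w_φ_ne_zero hx) fun j _ => hpow j x hx).ne h1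

theorem exists_w_smul_sub_smul [FaithfulSMul G L] {g h : G} (hgh : g ≠ h) :
    ∃ x : L, x ≠ 0 ∧ C.w (C.φ (g • x - h • x)) = C.w (C.φ x) := by
  obtain ⟨x, hx, hw⟩ := C.exists_w_smul_sub (g := h⁻¹ * g) (fun e => hgh (inv_mul_eq_one.mp e).symm)
  refine ⟨x, hx, ?_⟩
  rw [← hw, ← C.w_smul h ((h⁻¹ * g) • x - x), smul_sub, ← mul_smul, mul_inv_cancel_left]

/-- Projection to the `g`-component along `S` is a product of twisted commutators that do not
increase values. Tameness supplies for each `h ∈ S` an `x` whose difference `g • x - h • x` is as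
large as `x`, so dividing by it costs nothing. -/
theorem exists_contraction [FaithfulSMul G L] (g : G) (S : Finset G) (hS : g ∉ S) :
    ∃ T : D →+ D, (∀ d, C.w (T d) ≤ C.w d) ∧ (∀ a, T (C.φ a * C.y g) = C.φ a * C.y g) ∧
      (∀ h a, ∃ b, T (C.φ a * C.y h) = C.φ b * C.y h) ∧
      ∀ h ∈ S, ∀ a, T (C.φ a * C.y h) = 0 := by
  classical
  induction S using Finset.induction_on with
  | empty => exact ⟨AddMonoidHom.id D, fun _ => le_rfl, fun _ => rfl, fun h a => ⟨a, rfl⟩, by simp⟩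
  | insert h S hh ih =>
    obtain ⟨T, hT, hTg, hTk, hTS⟩ := ih fun hc => hS (Finset.mem_insert_of_mem hc)
    have hgh : g ≠ h := fun e => hS (e ▸ Finset.mem_insert_self _ _)
    obtain ⟨x, hx, hw⟩ := C.exists_w_smul_sub_smul hgh
    have hne : g • x - h • x ≠ 0 := fun e => by
      rw [e, map_zero, map_zero] at hw
      exact C.w_φ_ne_zero hx hw.symm
    -- `U` multiplies the `k`-component by `(k • x - h • x) / (g • x - h • x)`: it kills `h` and
    -- fixes `g`.
    let U : D →+ D :=
      { toFun := fun d => C.φ (g • x - h • x)⁻¹ * (d * C.φ x - C.φ (h • x) * d)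
        map_zero' := by simp
        map_add' := fun a b => by
          rw [← mul_add]
          congr 1
          rw [add_mul, mul_add]
          abel }
    have hU : ∀ d, U d = C.φ (g • x - h • x)⁻¹ * (d * C.φ x - C.φ (h • x) * d) := fun _ => rfl
    have hUk : ∀ k a, U (C.φ a * C.y k) =
        C.φ ((g • x - h • x)⁻¹ * (k • x - h • x) * a) * C.y k := by
      intro k a
      rw [hU, mul_assoc, C.y_mul, ← mul_assoc, ← mul_assoc, ← sub_mul, ← map_mul, ← map_mul,
        ← map_sub, ← mul_assoc, ← map_mul]
      congr 2
      ring
    have hUw : ∀ d, C.w (U d) ≤ C.w d := by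
      intro d
      have h1 : C.w (d * C.φ x - C.φ (h • x) * d) ≤ C.w (C.φ x) * C.w d :=
        (C.w.map_sub _ _).trans (max_le (by rw [map_mul, mul_comm])
          (by rw [map_mul, C.w_smul]))
      rw [hU, map_mul, map_inv₀, map_inv₀, hw]
      calc _ ≤ (C.w (C.φ x))⁻¹ * (C.w (C.φ x) * C.w d) := by gcongr
        _ = C.w d := inv_mul_cancel_left₀ (C.w_φ_ne_zero hx) _
    refine ⟨U.comp T, fun d => (hUw _).trans (hT d), fun a => ?_, fun k a => ?_, fun k hk a => ?_⟩
    · rw [AddMonoidHom.comp_apply, hTg, hUk, inv_mul_cancel₀ hne, one_mul]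
    · obtain ⟨b, hb⟩ := hTk k a
      exact ⟨_, by rw [AddMonoidHom.comp_apply, hb, hUk]⟩
    · rw [AddMonoidHom.comp_apply]
      rcases Finset.mem_insert.mp hk with rfl | hk
      · obtain ⟨b, hb⟩ := hTk k a
        rw [hb, hUk, sub_self]
        simp
      · rw [hTS k hk, map_zero]

theorem w_component_le [FaithfulSMul G L] (a : G → L) (g : G) :
    C.w (C.φ (a g) * C.y g) ≤ C.w (∑ h, C.φ (a h) * C.y h) := by
  classical
  obtain ⟨T, hT, hTg, -, hTS⟩ := C.exists_contraction g (Finset.univ.erase g) (by simp)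
  have : T (∑ h, C.φ (a h) * C.y h) = C.φ (a g) * C.y g := by
    rw [map_sum, Finset.sum_eq_single g, hTg]
    · intro h _ hne
      exact hTS h (by simp [hne]) _
    · simp
  rw [← this]
  exact hT _

/-- The value of the element inducing an automorphism, modulo the values of the subfield. -/
noncomputable def valueHom : G →* (WithZero (Multiplicative ℤ))ˣ ⧸
    (Units.map ((C.w : D →* WithZero (Multiplicative ℤ)).comp (C.φ : L →* D))).range where
  toFun g := QuotientGroup.mk (Units.mk0 (C.w (C.y g))
    ((Valuation.ne_zero_iff _).mpr (C.y_ne_zero g)))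
  map_one' := by
    rw [QuotientGroup.eq_one_iff]
    -- `y 1` need not be 1, but it centralizes `L` and so lies in `L`.
    obtain ⟨c, hc⟩ := C.exists_of_commute (C.y 1) (fun a => by rw [C.y_mul, one_smul])
    have hc0 : c ≠ 0 := fun h => C.y_ne_zero 1 (by rw [← hc, h, map_zero])
    exact ⟨Units.mk0 c hc0, Units.ext (congrArg C.w hc)⟩
  map_mul' g h := by
    rw [← QuotientGroup.mk_mul, QuotientGroup.eq]
    obtain ⟨c, hc0, hc⟩ := C.exists_y_mul_y g h
    refine ⟨Units.mk0 c hc0, Units.ext ?_⟩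
    change C.w (C.φ c) = (C.w (C.y (g * h)))⁻¹ * (C.w (C.y g) * C.w (C.y h))
    rw [← map_mul, hc, map_mul, mul_comm (C.w (C.φ c)), inv_mul_cancel_left₀]
    exact (Valuation.ne_zero_iff _).mpr (C.y_ne_zero _)

theorem mem_ker_valueHom {g : G} :
    g ∈ C.valueHom.ker ↔ ∃ a : L, a ≠ 0 ∧ C.w (C.φ a) = C.w (C.y g) := by
  rw [MonoidHom.mem_ker]
  change QuotientGroup.mk _ = _ ↔ _
  rw [QuotientGroup.eq_one_iff]
  constructor
  · rintro ⟨a, ha⟩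
    exact ⟨a, a.ne_zero, congrArg Units.val ha⟩
  · rintro ⟨a, ha, h⟩
    exact ⟨Units.mk0 a ha, Units.ext h⟩

theorem isCyclic_units_withZero : IsCyclic (WithZero (Multiplicative ℤ))ˣ :=
  isCyclic_of_surjective (WithZero.unitsWithZeroEquiv (α := Multiplicative ℤ)).symm
    (MulEquiv.surjective _)

theorem isCyclic_quotient_ker_valueHom : IsCyclic (G ⧸ C.valueHom.ker) := by
  have := isCyclic_units_withZero
  have : IsCyclic ((WithZero (Multiplicative ℤ))ˣ ⧸
      (Units.map ((C.w : D →* WithZero (Multiplicative ℤ)).comp (C.φ : L →* D))).range) :=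
    isCyclic_of_surjective (QuotientGroup.mk' _) (QuotientGroup.mk'_surjective _)
  exact isCyclic_of_injective (QuotientGroup.kerLift C.valueHom)
    (QuotientGroup.kerLift_injective _)

/-- The elements acting trivially on the residue field. -/
def inertia : Subgroup G where
  carrier := {g | ∀ a, C.w (C.φ a) ≤ 1 → C.w (C.φ (g • a - a)) < 1}
  one_mem' := fun a _ => by simp
  mul_mem' := fun {g h} hg hh a ha => by
    have e : (g * h) • a - a = g • (h • a - a) + (g • a - a) := by
      rw [mul_smul, smul_sub]
      ring
    rw [e, map_add]
    refine C.w.map_add_lt ?_ (hg a ha)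
    rw [C.w_smul]
    exact hh a ha
  inv_mem' := fun {g} hg a ha => by
    rw [← C.w_smul g, smul_sub, smul_inv_smul, ← neg_sub, map_neg, Valuation.map_neg]
    exact hg a ha

instance : C.inertia.Normal where
  conj_mem g hg h a ha := by
    have e : (h * g * h⁻¹) • a - a = h • (g • (h⁻¹ • a) - h⁻¹ • a) := by
      rw [smul_sub, smul_inv_smul, mul_smul, mul_smul]
    rw [e, C.w_smul]
    exact hg _ (by rwa [C.w_smul])

theorem exists_uniformizer : ∃ ρ : L, ρ ≠ 0 ∧
    ∀ x : L, x ≠ 0 → ∃ n : ℤ, C.w (C.φ x) = C.w (C.φ ρ) ^ n := by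
  have := isCyclic_units_withZero
  let W := (Units.map ((C.w : D →* WithZero (Multiplicative ℤ)).comp (C.φ : L →* D))).range
  obtain ⟨⟨_, ρ, rfl⟩, hρ⟩ := IsCyclic.exists_generator (α := W)
  refine ⟨ρ, ρ.ne_zero, fun x hx => ?_⟩
  obtain ⟨n, hn⟩ := Subgroup.mem_zpowers_iff.mp (hρ ⟨_, Units.mk0 x hx, rfl⟩)
  refine ⟨n, ?_⟩
  have := congrArg (fun t : W => ((t : (WithZero (Multiplicative ℤ))ˣ) :
    WithZero (Multiplicative ℤ))) hn
  simp only [SubgroupClass.coe_zpow, Units.val_zpow_eq_zpow_val] at this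
  exact this.symm

/-- The tame character sends `g` to the residue of `g • ρ / ρ`, for `ρ` generating the value group
of `L`. It is injective on inertia, and a finite subgroup of the units of a field is cyclic. -/
theorem isCyclic_inertia [FaithfulSMul G L] : IsCyclic C.inertia := by
  obtain ⟨ρ, hρ, hgen⟩ := C.exists_uniformizer
  let O := (C.w.comap C.φ).valuationSubring
  have hO : ∀ x : O, IsLocalRing.residue O x = 0 ↔ C.w (C.φ x) < 1 := fun x => by
    rw [IsLocalRing.residue_eq_zero_iff]
    exact Valuation.mem_maximalIdeal_iff _ (C.w.comap C.φ)
  have hunit : ∀ g : G, C.w (C.φ (g • ρ / ρ)) ≤ 1 := fun g => by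
    rw [map_div₀, map_div₀, C.w_smul, div_self (C.w_φ_ne_zero hρ)]
  let u : G → O := fun g => ⟨g • ρ / ρ, hunit g⟩
  let χ : C.inertia →* IsLocalRing.ResidueField O :=
    { toFun := fun g => IsLocalRing.residue O (u g)
      map_one' := by
        have : u (1 : C.inertia) = 1 := Subtype.ext (by simp [u, hρ])
        rw [this, map_one]
      map_mul' := fun g h => by
        rw [← map_mul, ← sub_eq_zero, ← map_sub, hO]
        have e : ((u ((g * h : C.inertia) : G) - u g * u h : O) : L) =
            ((g : G) • ((h : G) • ρ / ρ) - (h : G) • ρ / ρ) * ((g : G) • ρ / ρ) := by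
          change ((g * h : C.inertia) : G) • ρ / ρ - ((g : G) • ρ / ρ) * ((h : G) • ρ / ρ) = _
          have h0 : (g : G) • ρ ≠ 0 := (smul_ne_zero_iff_ne _).mpr hρ
          rw [Subgroup.coe_mul, mul_smul, smul_div₀']
          field_simp
        rw [e, map_mul, map_mul]
        exact mul_lt_one_of_nonneg_of_lt_one_left zero_le (g.2 _ (hunit h)) (hunit g) }
  refine isCyclic_of_injective_ringHom χ ((injective_iff_map_eq_one χ).mpr fun g hg => ?_)
  by_contra hne
  have hg1 : (g : G) ≠ 1 := fun h => hne (Subtype.ext h)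
  -- For `g` in the kernel, the `x` with `g • x / x` of residue 1 form a group containing `ρ` and
  -- all units, hence all of `Lˣ`; this contradicts tameness.
  let Q : Subgroup Lˣ :=
    { carrier := {x | C.w (C.φ ((g : G) • (x : L) / x - 1)) < 1}
      one_mem' := by simp
      mul_mem' := fun {x z} hx hz => by
        have e : (g : G) • ((x * z : Lˣ) : L) / ((x * z : Lˣ) : L) - 1 =
            ((g : G) • (x : L) / x) * ((g : G) • (z : L) / z - 1) +
              ((g : G) • (x : L) / x - 1) := by
          rw [Units.val_mul, smul_mul']
          field_simp
          ring
        change C.w _ < 1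
        rw [e, map_add, map_mul]
        refine C.w.map_add_lt ?_ hx
        rw [map_mul, map_div₀, map_div₀, C.w_smul, div_self (C.w_φ_ne_zero x.ne_zero), one_mul]
        exact hz
      inv_mem' := fun {x} hx => by
        have h0 : (g : G) • (x : L) ≠ 0 := (smul_ne_zero_iff_ne _).mpr x.ne_zero
        have e : (g : G) • ((x⁻¹ : Lˣ) : L) / ((x⁻¹ : Lˣ) : L) - 1 =
            -((x : L) / (g : G) • (x : L)) * ((g : G) • (x : L) / x - 1) := by
          rw [Units.val_inv_eq_inv_val, smul_inv₀']
          field_simp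
          ring
        change C.w _ < 1
        rw [e, map_mul, map_mul, map_neg, Valuation.map_neg, map_div₀, map_div₀, C.w_smul,
          div_self (C.w_φ_ne_zero x.ne_zero), one_mul]
        exact hx }
  have hρQ : Units.mk0 ρ hρ ∈ Q := by
    have h1 : IsLocalRing.residue O (u g - 1) = 0 := by
      rw [map_sub, map_one, sub_eq_zero]
      exact hg
    exact (hO _).mp h1
  have hunitQ : ∀ x : Lˣ, C.w (C.φ x) = 1 → x ∈ Q := fun x hx => by
    have e : (g : G) • (x : L) / x - 1 = ((g : G) • (x : L) - x) / x := by
      field_simp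
    change C.w _ < 1
    rw [e, map_div₀, map_div₀, hx, div_one]
    exact g.2 _ hx.le
  obtain ⟨x, hx, hw⟩ := C.exists_w_smul_sub hg1
  obtain ⟨n, hn⟩ := hgen x hx
  have hxQ : Units.mk0 x hx ∈ Q := by
    have h1 : Units.mk0 x hx * (Units.mk0 ρ hρ ^ n)⁻¹ ∈ Q := hunitQ _ (by
      rw [Units.val_mul, Units.val_inv_eq_inv_val, Units.val_zpow_eq_zpow_val, Units.val_mk0,
        Units.val_mk0, map_mul, map_mul, map_inv₀, map_inv₀, map_zpow₀, map_zpow₀, hn,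
        mul_inv_cancel₀ (zpow_ne_zero _ (C.w_φ_ne_zero hρ))])
    simpa using Q.mul_mem h1 (Q.zpow_mem hρQ n)
  have h2 : C.w (C.φ (g • x / x - 1)) < 1 := hxQ
  have e : (g : G) • x / x - 1 = ((g : G) • x - x) / x := by
    field_simp
  rw [show g • x = (g : G) • x from rfl, e, map_div₀, map_div₀, hw,
    div_self (C.w_φ_ne_zero hx)] at h2
  exact lt_irrefl _ h2

end ValuedCrossedProduct

/-! ### Admissibility from a group acting on a self-centralizing subfield -/

theorem isGalois_of_finite_subgroup_fixed {E F : Type*} [Field E] [Field F] [Algebra E F]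
    (H : Subgroup Gal(F/E)) [Finite H]
    (hfix : ∀ x : F, (∀ s ∈ H, s x = x) → ∃ e, algebraMap E F e = x) :
    IsGalois E F ∧ FiniteDimensional E F ∧ Nonempty (Gal(F/E) ≃* H) := by
  have : IsGaloisGroup H E F :=
    { faithful := inferInstance
      commutes := inferInstance
      isInvariant := ⟨fun x hx => hfix x fun s hs => hx ⟨s, hs⟩⟩ }
  exact ⟨IsGaloisGroup.isGalois H E F, IsGaloisGroup.finiteDimensional H E F,
    ⟨(IsGaloisGroup.mulEquivAlgEquiv H E F).symm⟩⟩

theorem isMaximalSubfield_of_commute {K : Type u} {D : Type v} [Field K] [DivisionRing D]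
    [Algebra K D] {M : Subalgebra K D} (hM : IsField M)
    (hmax : ∀ x, (∀ a ∈ M, x * a = a * x) → x ∈ M) : IsMaximalSubfield K D M :=
  ⟨hM, fun _ hN hMN x hx => hmax x fun a ha =>
    congrArg Subtype.val (hN.mul_comm ⟨x, hx⟩ ⟨a, hMN ha⟩)⟩

/-- A self-centralizing subfield with a finite group of automorphisms fixing only the center makes
the group modulo the kernel of the action admissible. -/
theorem isAdmissible_quotient_of_action {E R : Type u} [Field E] [DivisionRing R] [Algebra E R]
    [Algebra.IsCentral E R] (M : Subalgebra E R) (hM : IsField M)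
    (hmax : ∀ x, (∀ a ∈ M, x * a = a * x) → x ∈ M) {N : Type v} [Group N] [Finite N]
    (θ : N →* (M →ₐ[E] M))
    (hfix : ∀ x : M, (∀ n, θ n x = x) → ∃ e, algebraMap E M e = x)
    (Q : Subgroup N) [Q.Normal] (hQ : ∀ n, n ∈ Q ↔ θ n = 1) : IsAdmissible E (N ⧸ Q) := by
  let _ : Field M := hM.toField
  let ψ : N →* Gal(M/E) := (AlgEquiv.algHomUnitsEquiv E M : _ →* Gal(M/E)).comp θ.toHomUnits
  have hψ : ∀ n x, ψ n x = θ n x := fun n x => rfl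
  have hker : ψ.ker = Q := by
    ext n
    rw [MonoidHom.mem_ker, hQ]
    exact ⟨fun h => AlgHom.ext fun x => DFunLike.congr_fun h x,
      fun h => AlgEquiv.ext fun x => DFunLike.congr_fun h x⟩
  have : Finite ψ.range := Set.finite_range ψ
  obtain ⟨h1, h2, ⟨e⟩⟩ := isGalois_of_finite_subgroup_fixed ψ.range
    (fun x hx => hfix x fun n => hx _ ⟨n, rfl⟩)
  refine ⟨M, inferInstance, inferInstance, h1, ⟨e.trans
    ((QuotientGroup.quotientKerEquivRange ψ).symm.trans
      (QuotientGroup.quotientMulEquivOfEq hker))⟩, h2, R, inferInstance, inferInstance, M.val,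
    inferInstance, ?_⟩
  rw [Subalgebra.range_val]
  exact isMaximalSubfield_of_commute hM hmax

instance Subring.center.isCentral (R : Type*) [DivisionRing R] :
    Algebra.IsCentral (Subring.center R) R where
  out := fun x hx => by
    rw [Subalgebra.mem_center_iff] at hx
    exact Algebra.mem_bot.mpr ⟨⟨x, Subring.mem_center_iff.mpr hx⟩, rfl⟩

/-! ### The residue division ring as a crossed product -/

namespace ValuedCrossedProduct

variable {G L D R : Type*} [Group G] [Fintype G] [Field L] [MulSemiringAction G L]
  [DivisionRing D] (C : ValuedCrossedProduct G L D) [DivisionRing R] (r : ResidueMap C.w R)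

/-- The residues of the elements of the subfield. -/
def residueSet : Set R := {t | ∃ a, C.w (C.φ a) ≤ 1 ∧ r.res (C.φ a) = t}

theorem exists_unit (g : C.valueHom.ker) :
    ∃ z : D, C.w z = 1 ∧ (∀ a, z * C.φ a = C.φ ((g : G) • a) * z) := by
  obtain ⟨a, ha, hw⟩ := C.mem_ker_valueHom.mp g.2
  refine ⟨C.φ a⁻¹ * C.y g, ?_, fun b => ?_⟩
  · rw [map_mul, ← hw, ← map_mul, ← map_mul, inv_mul_cancel₀ ha, map_one, map_one]
  · rw [mul_assoc, C.y_mul, ← mul_assoc, ← mul_assoc, ← map_mul, ← map_mul, mul_comm]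

/-- A unit of the valuation ring inducing a given automorphism. -/
noncomputable def z (g : C.valueHom.ker) : D := (C.exists_unit g).choose

theorem w_z (g) : C.w (C.z g) = 1 := (C.exists_unit g).choose_spec.1

theorem z_mul (g) (a : L) : C.z g * C.φ a = C.φ ((g : G) • a) * C.z g :=
  (C.exists_unit g).choose_spec.2 a

theorem z_ne_zero (g) : C.z g ≠ 0 := fun h => by
  have := C.w_z g
  simp [h] at this

theorem exists_z_mul_z (g h) : ∃ c, C.w (C.φ c) = 1 ∧ C.z g * C.z h = C.φ c * C.z (g * h) := by
  obtain ⟨c, hc⟩ := C.exists_eq_mul (g := (g * h : C.valueHom.ker)) (u := C.z g * C.z h)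
    (v := C.z (g * h))
    (fun a => by rw [mul_assoc, C.z_mul, ← mul_assoc, C.z_mul, Subgroup.coe_mul, mul_smul,
      mul_assoc]) (C.z_mul _) (C.z_ne_zero _)
  refine ⟨c, ?_, hc⟩
  have := congrArg C.w hc
  rw [map_mul, map_mul, C.w_z, C.w_z, C.w_z, mul_one, mul_one] at this
  exact this.symm

theorem res_z_mul (g) {a : L} (ha : C.w (C.φ a) ≤ 1) :
    r.res (C.z g) * r.res (C.φ a) = r.res (C.φ ((g : G) • a)) * r.res (C.z g) := by
  rw [← r.res_mul (C.w_z g).le ha, C.z_mul, r.res_mul (by rwa [C.w_smul]) (C.w_z g).le]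

/-- Lift `t` to `∑ φ(a g) y g`. Every component is integral by `w_component_le`, and one of value 1
forces the value of `y g` into that of `L`, so only `g` in the kernel survive reduction. -/
theorem exists_sum_res [FaithfulSMul G L] [Fintype C.valueHom.ker] (t : R) :
    ∃ b : C.valueHom.ker → L, (∀ g, C.w (C.φ (b g)) ≤ 1) ∧
      t = ∑ g, r.res (C.φ (b g)) * r.res (C.z g) := by
  classical
  obtain ⟨d, hd, rfl⟩ := r.exists_res t
  obtain ⟨a, ha⟩ := C.exists_sum d
  have hle : ∀ g, C.w (C.φ (a g) * C.y g) ≤ 1 := fun g =>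
    (C.w_component_le a g).trans (ha ▸ hd)
  have hb : ∀ g : C.valueHom.ker, ∃ b, C.w (C.φ b) ≤ 1 ∧ C.φ (a g) * C.y g = C.φ b * C.z g := by
    intro g
    obtain ⟨c, hc⟩ := C.exists_eq_mul (C.y_mul g) (C.z_mul g) (C.z_ne_zero g)
    have e : C.φ (a g) * C.y g = C.φ (a g * c) * C.z g := by rw [hc, map_mul, mul_assoc]
    refine ⟨a g * c, ?_, e⟩
    have h := hle g
    rwa [e, map_mul, C.w_z, mul_one] at h
  choose b hb1 hb2 using hb
  refine ⟨b, hb1, ?_⟩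
  rw [ha, r.res_sum _ _ fun g _ => hle g]
  rw [← Finset.sum_filter_of_ne (p := fun g => g ∈ C.valueHom.ker)]
  · rw [Finset.sum_subtype _ (p := fun g => g ∈ C.valueHom.ker)
      fun g => Finset.mem_filter.trans (and_iff_right (Finset.mem_univ g))]
    refine Finset.sum_congr rfl fun g _ => ?_
    rw [hb2, r.res_mul (hb1 g) (C.w_z g).le]
  · intro g _ hg
    have h1 := r.eq_one_of_res_ne_zero (hle g) hg
    have h0 : a g ≠ 0 := fun h => by
      rw [h] at h1
      simp at h1
    refine C.mem_ker_valueHom.mpr ⟨(a g)⁻¹, inv_ne_zero h0, ?_⟩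
    rw [map_mul] at h1
    rw [map_inv₀, map_inv₀]
    exact inv_eq_of_mul_eq_one_right h1

theorem res_eq_zero_of_sum [FaithfulSMul G L] [Fintype C.valueHom.ker] (b : C.valueHom.ker → L)
    (hb : ∀ g, C.w (C.φ (b g)) ≤ 1) (hsum : ∑ g, r.res (C.φ (b g)) * r.res (C.z g) = 0) (g) :
    r.res (C.φ (b g)) = 0 := by
  classical
  have hle : ∀ g, C.w (C.φ (b g) * C.z g) ≤ 1 := fun g => by
    rw [map_mul, C.w_z, mul_one]
    exact hb g
  have hz : ∀ g : C.valueHom.ker, ∃ c, C.z g = C.φ c * C.y g := fun g =>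
    C.exists_eq_mul (C.z_mul g) (C.y_mul g) (C.y_ne_zero g)
  choose c hc using hz
  let a : G → L := fun g => if h : g ∈ C.valueHom.ker then b ⟨g, h⟩ * c ⟨g, h⟩ else 0
  have haz : ∀ g : C.valueHom.ker, C.φ (b g) * C.z g = C.φ (a g) * C.y g := fun g => by
    have h : a g = b g * c g := dif_pos g.2
    rw [hc, ← mul_assoc, ← map_mul, h]
  have e : ∑ g, C.φ (a g) * C.y g = ∑ g, C.φ (b g) * C.z g := by
    rw [← Finset.sum_filter_of_ne (p := fun g => g ∈ C.valueHom.ker),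
      Finset.sum_subtype _ (p := fun g => g ∈ C.valueHom.ker)
      fun g => Finset.mem_filter.trans (and_iff_right (Finset.mem_univ g))]
    · exact Finset.sum_congr rfl fun g _ => (haz g).symm
    · intro g _ hg
      by_contra h
      have h' : a g = 0 := dif_neg h
      exact hg (by rw [h', map_zero, zero_mul])
  have h1 : r.res (∑ g, C.φ (b g) * C.z g) = 0 := by
    rw [r.res_sum _ _ fun g _ => hle g, ← hsum]
    exact Finset.sum_congr rfl fun g _ => r.res_mul (hb g) (C.w_z g).le
  rw [r.res_eq_zero (C.w.map_sum_le fun g _ => hle g), ← e] at h1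
  have h2 := (C.w_component_le a g).trans_lt h1
  rw [← haz, map_mul, C.w_z, mul_one] at h2
  exact (r.res_eq_zero (hb g)).mpr h2

/-- The inertia subgroup of the group of automorphisms induced by units. -/
noncomputable def unitInertia : Subgroup G := C.valueHom.ker ⊓ C.inertia

instance : C.unitInertia.Normal := Subgroup.normal_inf_normal _ _

theorem isCyclic_unitInertia [FaithfulSMul G L] : IsCyclic C.unitInertia := by
  have := C.isCyclic_inertia
  exact isCyclic_of_injective (Subgroup.inclusion (inf_le_right : C.unitInertia ≤ C.inertia))
    (Subgroup.inclusion_injective _)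

theorem res_smul_eq {g : G} (hg : g ∈ C.inertia) {a : L} (ha : C.w (C.φ a) ≤ 1) :
    r.res (C.φ (g • a)) = r.res (C.φ a) := by
  rw [← sub_eq_zero, ← r.res_sub (by rwa [C.w_smul]) ha, ← map_sub]
  have h := hg a ha
  exact (r.res_eq_zero h.le).mpr h

theorem commute_residueSet {s t : R} (hs : s ∈ C.residueSet r) (ht : t ∈ C.residueSet r) :
    s * t = t * s := by
  obtain ⟨a, ha, rfl⟩ := hs
  obtain ⟨b, hb, rfl⟩ := ht
  rw [← r.res_mul ha hb, ← r.res_mul hb ha, ← map_mul, ← map_mul, mul_comm]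

/-- The elements commuting with the residue field of the subfield are combinations of the residues
of the units inducing inertial automorphisms. -/
theorem exists_sum_of_commute [FaithfulSMul G L] [Fintype C.valueHom.ker] {t : R}
    (ht : ∀ s ∈ C.residueSet r, s * t = t * s) :
    ∃ b : C.valueHom.ker → L, (∀ g, C.w (C.φ (b g)) ≤ 1) ∧
      (∀ g, r.res (C.φ (b g)) ≠ 0 → (g : G) ∈ C.inertia) ∧
      t = ∑ g, r.res (C.φ (b g)) * r.res (C.z g) := by
  obtain ⟨b, hb, hsum⟩ := C.exists_sum_res r t
  refine ⟨b, hb, fun g hg a ha => ?_, hsum⟩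
  have hga : ∀ h : C.valueHom.ker, C.w (C.φ ((h : G) • a - a)) ≤ 1 := fun h => by
    rw [map_sub]
    exact (C.w.map_sub _ _).trans (max_le (by rwa [C.w_smul]) ha)
  have hwb : ∀ h : C.valueHom.ker, C.w (C.φ (((h : G) • a - a) * b h)) ≤ 1 := fun h => by
    rw [map_mul, map_mul]
    exact mul_le_one' (hga h) (hb h)
  -- Commuting with the residue of `a` multiplies the coefficient at `h` by the residue of `h • a -
  -- a`; independence of the `z h` makes each product vanish.
  have h1 : ∑ h : C.valueHom.ker, r.res (C.φ (((h : G) • a - a) * b h)) * r.res (C.z h) = 0 := by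
    have h2 := ht _ ⟨a, ha, rfl⟩
    rw [hsum, Finset.mul_sum, Finset.sum_mul, eq_comm, ← sub_eq_zero,
      ← Finset.sum_sub_distrib] at h2
    rw [← h2]
    refine Finset.sum_congr rfl fun h _ => ?_
    rw [mul_assoc, C.res_z_mul r h ha, ← mul_assoc, ← mul_assoc, ← sub_mul]
    congr 1
    rw [C.commute_residueSet r ⟨_, hb h, rfl⟩ ⟨(h : G) • a, by rwa [C.w_smul], rfl⟩, ← sub_mul,
      ← r.res_sub (by rwa [C.w_smul]) ha, ← map_sub, map_mul, r.res_mul (hga h) (hb h)]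
  have h3 := C.res_eq_zero_of_sum r _ hwb h1 g
  rw [map_mul, r.res_mul (hga g) (hb g)] at h3
  exact (r.res_eq_zero (hga g)).mp ((mul_eq_zero.mp h3).resolve_right hg)

/-- With `g'` generating the cyclic group `P₂`, the centralizer is generated by the residue field of
`L` and the single residue of `z g'`, which commute with each other. -/
theorem commute_of_commute_residueSet [FaithfulSMul G L] {s t : R}
    (hs : ∀ l ∈ C.residueSet r, l * s = s * l) (ht : ∀ l ∈ C.residueSet r, l * t = t * l) :
    s * t = t * s := by
  classical
  have := C.isCyclic_unitInertia
  obtain ⟨⟨g, hg⟩, hgen⟩ := IsCyclic.exists_generator (α := C.unitInertia)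
  let g' : C.valueHom.ker := ⟨g, hg.1⟩
  have hcomb : ∀ {s t : R}, (∀ l ∈ C.residueSet r, l * s = s * l) →
      (∀ l ∈ C.residueSet r, l * t = t * l) →
      (∀ h : C.valueHom.ker, (h : G) ∈ C.inertia →
        r.res (C.z h) * s = s * r.res (C.z h)) → t * s = s * t := by
    intro s t hs ht hz
    obtain ⟨b, hb, hbi, hsum⟩ := C.exists_sum_of_commute r ht
    rw [hsum, Finset.sum_mul, Finset.mul_sum]
    refine Finset.sum_congr rfl fun h _ => ?_
    by_cases h0 : r.res (C.φ (b h)) = 0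
    · simp [h0]
    · rw [mul_assoc, hz h (hbi h h0), ← mul_assoc, hs _ ⟨_, hb h, rfl⟩, mul_assoc]
  have hzc : ∀ h : C.valueHom.ker, (h : G) ∈ C.inertia → ∀ l ∈ C.residueSet r,
      l * r.res (C.z h) = r.res (C.z h) * l := by
    rintro h hh _ ⟨a, ha, rfl⟩
    rw [C.res_z_mul r h ha, C.res_smul_eq r hh ha]
  have hgi : ∀ h : C.valueHom.ker, (h : G) ∈ C.inertia → h ∈ Submonoid.powers g' := by
    intro h hh
    obtain ⟨n, hn⟩ := (mem_powers_iff_mem_zpowers.mpr (hgen ⟨h, h.2, hh⟩))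
    have hn' := congrArg Subtype.val hn
    exact ⟨n, Subtype.ext hn'⟩
  have hzg : ∀ s : R, (∀ l ∈ C.residueSet r, l * s = s * l) →
      r.res (C.z g') * s = s * r.res (C.z g') →
      ∀ h : C.valueHom.ker, (h : G) ∈ C.inertia → r.res (C.z h) * s = s * r.res (C.z h) := by
    intro s hs hgs h hh
    obtain ⟨n, rfl⟩ := hgi h hh
    have hpow : ∀ n : ℕ, ∃ c, C.w (C.φ c) = 1 ∧ C.z (g' ^ n) = C.φ c * C.z g' ^ n := by
      intro n
      have hpz : ∀ a, C.z g' ^ n * C.φ a = C.φ (((g' ^ n : C.valueHom.ker) : G) • a) *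
          C.z g' ^ n := by
        induction n with
        | zero =>
          intro a
          rw [pow_zero, pow_zero, Subgroup.coe_one, one_smul, one_mul, mul_one]
        | succ n ih =>
          intro a
          rw [pow_succ, mul_assoc, C.z_mul, ← mul_assoc, ih, pow_succ,
            Subgroup.coe_mul, mul_smul, mul_assoc]
      obtain ⟨c, hc⟩ := C.exists_eq_mul (C.z_mul _) hpz (pow_ne_zero _ (C.z_ne_zero _))
      refine ⟨c, ?_, hc⟩
      have h1 := congrArg C.w hc
      rw [map_mul, map_pow, C.w_z, C.w_z, one_pow, mul_one] at h1
      exact h1.symm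
    have hres : ∀ n : ℕ, r.res (C.z g' ^ n) = r.res (C.z g') ^ n := by
      intro n
      induction n with
      | zero => simp [r.res_one]
      | succ n ih => rw [pow_succ, pow_succ, r.res_mul (by simp [C.w_z]) (C.w_z _).le, ih]
    obtain ⟨c, hc1, hc⟩ := hpow n
    change r.res (C.z (g' ^ n)) * s = s * r.res (C.z (g' ^ n))
    rw [hc, r.res_mul hc1.le (by simp [C.w_z]), hres]
    have h1 : Commute (r.res (C.φ c)) s := hs _ ⟨c, hc1.le, rfl⟩
    have h2 : Commute (r.res (C.z g')) s := hgs
    exact h1.mul_left (h2.pow_left n)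
  have hg' : ∀ l ∈ C.residueSet r, l * r.res (C.z g') = r.res (C.z g') * l := hzc g' hg.2
  -- `hcomb` is used twice: the residue of `z g'` commutes with itself, hence with every `t` in the
  -- centralizer; then so does each inertial `z h`, so `t` commutes with every `s`.
  refine (hcomb ht hs (hzg t ht ?_))
  exact (hcomb hg' ht (hzg _ hg' rfl)).symm

end ValuedCrossedProduct

theorem ValuedCrossedProduct.isAdmissible {G L D : Type*} {R : Type u} [Group G] [Fintype G]
    [Field L] [MulSemiringAction G L] [FaithfulSMul G L] [DivisionRing D]
    (C : ValuedCrossedProduct G L D) [DivisionRing R] (r : ResidueMap C.w R) :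
    IsAdmissible (Subring.center R)
      (C.valueHom.ker ⧸ C.unitInertia.subgroupOf C.valueHom.ker) := by
  classical
  -- The residue field of `L` may be too small to be maximal in `R`; its centralizer is the maximal
  -- subfield.
  let M : Subalgebra (Subring.center R) R := Subalgebra.centralizer _ (C.residueSet r)
  have hMmem : ∀ {x}, x ∈ M ↔ ∀ l ∈ C.residueSet r, l * x = x * l :=
    Subalgebra.mem_centralizer_iff _
  have hlM : ∀ l ∈ C.residueSet r, l ∈ M := fun l hl => hMmem.mpr fun l' hl' =>
    C.commute_residueSet r hl' hl
  have hMcomm : ∀ x ∈ M, ∀ y ∈ M, x * y = y * x := fun x hx y hy =>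
    C.commute_of_commute_residueSet r (hMmem.mp hx) (hMmem.mp hy)
  have hM : IsField M :=
    { exists_pair_ne := ⟨0, 1, zero_ne_one⟩
      mul_comm := fun a b => Subtype.ext (hMcomm a a.2 b b.2)
      mul_inv_cancel := fun {a} ha => ⟨⟨(a : R)⁻¹, Subalgebra.inv_mem_centralizer a.2⟩,
        Subtype.ext (mul_inv_cancel₀ fun h => ha (Subtype.ext h))⟩ }
  have hmax : ∀ x, (∀ a ∈ M, x * a = a * x) → x ∈ M := fun x hx =>
    hMmem.mpr fun l hl => (hx l (hlM l hl)).symm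
  have hz0 : ∀ g, r.res (C.z g) ≠ 0 := fun g => r.res_ne_zero (C.w_z g)
  have hconj : ∀ g, ∀ x ∈ M, r.res (C.z g) * x * (r.res (C.z g))⁻¹ ∈ M := by
    intro g x hx
    rw [hMmem]
    rintro _ ⟨a, ha, rfl⟩
    have ha' : C.w (C.φ ((g : G)⁻¹ • a)) ≤ 1 := by rwa [C.w_smul]
    have h1 := C.res_z_mul r g ha'
    rw [smul_inv_smul] at h1
    have h2 : (r.res (C.z g))⁻¹ * r.res (C.φ a) =
        r.res (C.φ ((g : G)⁻¹ • a)) * (r.res (C.z g))⁻¹ := by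
      rw [inv_mul_eq_iff_eq_mul₀ (hz0 g), ← mul_assoc, h1, mul_assoc, mul_inv_cancel₀ (hz0 g),
        mul_one]
    rw [mul_assoc _ _ (r.res (C.φ a)), h2, ← mul_assoc, ← mul_assoc, ← mul_assoc, ← h1,
      mul_assoc (r.res (C.z g)) x, ← hMmem.mp hx _ ⟨_, ha', rfl⟩, ← mul_assoc]
  let conj : C.valueHom.ker → (M →ₐ[Subring.center R] M) := fun g =>
    { toFun := fun x => ⟨_, hconj g x x.2⟩
      map_one' := Subtype.ext (by simp [hz0])
      map_mul' := fun x y => Subtype.ext (by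
        simp only [Subalgebra.coe_mul, mul_assoc, inv_mul_cancel_left₀ (hz0 g)])
      map_zero' := Subtype.ext (by simp)
      map_add' := fun x y => Subtype.ext (by simp [mul_add, add_mul])
      commutes' := fun e => Subtype.ext (by
        change r.res (C.z g) * (e : R) * _ = e
        rw [Subring.mem_center_iff.mp e.2, mul_assoc, mul_inv_cancel₀ (hz0 g), mul_one]) }
  have hconj_eq : ∀ g (x : M) (y : R), y * r.res (C.z g) = r.res (C.z g) * x ↔
      (conj g x : R) = y := fun g x y => by
    change _ ↔ r.res (C.z g) * x * (r.res (C.z g))⁻¹ = y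
    rw [mul_inv_eq_iff_eq_mul₀ (hz0 g), eq_comm]
  have hconj_mul : ∀ g (x : M), (conj g x : R) * r.res (C.z g) = r.res (C.z g) * x :=
    fun g x => (hconj_eq g x _).mpr rfl
  let θ : C.valueHom.ker →* (M →ₐ[Subring.center R] M) :=
    { toFun := conj
      map_one' := AlgHom.ext fun x => Subtype.ext ((hconj_eq _ _ _).mp (by
        obtain ⟨c, hc⟩ := C.exists_of_commute (C.z 1) (fun a => by
          rw [C.z_mul, Subgroup.coe_one, one_smul])
        rw [← hc]
        exact (hMmem.mp x.2 _ ⟨c, by rw [hc, C.w_z], rfl⟩).symm))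
      map_mul' := fun g h => AlgHom.ext fun x => Subtype.ext ((hconj_eq _ _ _).mp (by
        obtain ⟨c, hc1, hc⟩ := C.exists_z_mul_z g h
        have h1 := congrArg r.res hc
        rw [r.res_mul (C.w_z g).le (C.w_z h).le, r.res_mul hc1.le (C.w_z _).le] at h1
        refine mul_left_cancel₀ (r.res_ne_zero hc1) ?_
        change _ * ((conj g (conj h x) : M) * r.res (C.z (g * h)) : R) = _
        rw [← mul_assoc, hMmem.mp (conj g (conj h x)).2 _ ⟨c, hc1.le, rfl⟩, mul_assoc, ← h1,
          ← mul_assoc, hconj_mul, mul_assoc, hconj_mul, ← mul_assoc, h1, mul_assoc])) }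
  refine isAdmissible_quotient_of_action M hM hmax θ ?_ _ ?_
  · intro x hx
    have hcen : (x : R) ∈ Subring.center R := by
      rw [Subring.mem_center_iff]
      intro t
      obtain ⟨b, hb, rfl⟩ := C.exists_sum_res r t
      rw [Finset.sum_mul, Finset.mul_sum]
      refine Finset.sum_congr rfl fun g _ => ?_
      have h1 : r.res (C.z g) * x = x * r.res (C.z g) := by
        have := hconj_mul g x
        rw [← this]
        congr 1
        exact congrArg Subtype.val (hx g)
      rw [mul_assoc, h1, ← mul_assoc, hMmem.mp x.2 _ ⟨_, hb g, rfl⟩, mul_assoc]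
    exact ⟨⟨x, hcen⟩, rfl⟩
  · intro g
    rw [Subgroup.mem_subgroupOf]
    constructor
    · intro hg
      refine AlgHom.ext fun x => Subtype.ext ((hconj_eq g x x).mp ?_)
      refine hMcomm _ x.2 _ (hMmem.mpr ?_)
      rintro _ ⟨a, ha, rfl⟩
      rw [C.res_z_mul r g ha, C.res_smul_eq r hg.2 ha]
    · intro hg
      refine ⟨g.2, fun a ha => ?_⟩
      have ha' : C.w (C.φ ((g : G) • a)) ≤ 1 := by rwa [C.w_smul]
      have h1 := hconj_mul g ⟨_, hlM _ ⟨a, ha, rfl⟩⟩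
      have h2 := congrArg Subtype.val (DFunLike.congr_fun hg ⟨_, hlM _ ⟨a, ha, rfl⟩⟩)
      change (conj g _ : R) = r.res (C.φ a) at h2
      rw [h2] at h1
      change r.res (C.φ a) * _ = _ * r.res (C.φ a) at h1
      rw [C.res_z_mul r g ha] at h1
      have h3 := mul_right_cancel₀ (hz0 g) h1
      have h4 : C.w (C.φ ((g : G) • a - a)) ≤ 1 := by
        rw [map_sub]
        exact (C.w.map_sub _ _).trans (max_le ha' ha)
      rw [← r.res_eq_zero h4, map_sub, r.res_sub ha' ha, h3, sub_self]

/-! ### Finiteness over the residue field, and the conclusion -/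

/-- Lifts to `D` of elements of `E` independent over `k` are independent over `K`, so the degree of
`E` is at most that of `D`. -/
theorem finiteDimensional_of_residueMap {K k E D R : Type*} [Field K]
    [Valued K (WithZero (Multiplicative ℤ))] [DivisionRing D] [Algebra K D]
    [FiniteDimensional K D] {w : Valuation D (WithZero (Multiplicative ℤ))}
    (hw : ∀ x : K, (Valued.v x : WithZero (Multiplicative ℤ)) ≤ 1 → w (algebraMap K D x) ≤ 1)
    [Ring R] (r : ResidueMap w R) [Field k] [Field E] [Algebra k E] (ι : E →+* R)
    (π : Valued.integer K →+* k)
    (hπ : ∀ x : Valued.integer K, ι (algebraMap k E (π x)) = r.res (algebraMap K D x)) :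
    FiniteDimensional k E := by
  classical
  have hrank : Module.rank k E ≤ Module.finrank K D := by
    refine rank_le fun s hs => ?_
    choose d hd hdr using fun e : s => r.exists_res (ι (e : E))
    suffices LinearIndependent K d by
      simpa using this.fintype_card_le_finrank
    rw [Fintype.linearIndependent_iff] at hs ⊢
    intro c hc i
    by_contra hi
    -- Dividing a relation by its largest coefficient makes it integral with one coefficient 1, so
    -- it reduces to a nontrivial relation over `k`.
    obtain ⟨j, -, hj⟩ := Finset.exists_max_image Finset.univ
      (fun i => (Valued.v (c i) : WithZero (Multiplicative ℤ))) ⟨i, Finset.mem_univ i⟩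
    have hcj : c j ≠ 0 := fun h => by
      have := hj i (Finset.mem_univ i)
      rw [h, map_zero, le_zero_iff, Valuation.zero_iff] at this
      exact hi this
    have hvj : (Valued.v (c j) : WithZero (Multiplicative ℤ)) ≠ 0 :=
      (Valuation.ne_zero_iff _).mpr hcj
    let b : s → Valued.integer K := fun i => ⟨(c j)⁻¹ * c i, by
      change (Valued.v _ : WithZero (Multiplicative ℤ)) ≤ 1
      rw [map_mul, map_inv₀]
      calc _ ≤ (Valued.v (c j) : WithZero (Multiplicative ℤ))⁻¹ * Valued.v (c j) := by
            gcongr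
            exact hj i (Finset.mem_univ i)
        _ = 1 := inv_mul_cancel₀ hvj⟩
    have hb : ∑ i, algebraMap K D (b i) * d i = 0 := by
      have := congrArg (fun t => (c j)⁻¹ • t) hc
      simp only [Finset.smul_sum, smul_zero, smul_smul] at this
      rw [← this]
      exact Finset.sum_congr rfl fun i _ => (Algebra.smul_def _ _).symm
    have hbw : ∀ i, w (algebraMap K D (b i)) ≤ 1 := fun i => hw _ (b i).2
    have h1 := congrArg r.res hb
    rw [r.res_zero, r.res_sum _ _ fun i _ => by
      rw [map_mul]
      exact mul_le_one' (hbw i) (hd i)] at h1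
    have h2 : ι (∑ i, π (b i) • (i : E)) = 0 := by
      rw [← h1, map_sum]
      refine Finset.sum_congr rfl fun i _ => ?_
      rw [r.res_mul (hbw i) (hd i), Algebra.smul_def, map_mul, hπ, hdr]
    have : Nontrivial R := ⟨⟨r.res 1, 0, fun h => by
      have := (r.res_eq_zero w.map_one.le).mp h
      simp at this⟩⟩
    have h3 := hs (fun i => π (b i)) (ι.injective (h2.trans (map_zero ι).symm)) j
    have h4 : b j = 1 := Subtype.ext (inv_mul_cancel₀ hcj)
    rw [h4, map_one] at h3
    exact one_ne_zero h3
  exact Module.rank_lt_aleph0_iff.mp (hrank.trans_lt (Cardinal.natCast_lt_aleph0))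

/-- A division algebra over a complete discretely valued field that is a tame crossed product for a
group `P` yields a normal series of `P` with cyclic ends and a residually admissible middle. -/
theorem exists_normal_series_of_crossedProduct (K : Type u) [Field K]
    [Valued K (WithZero (Multiplicative ℤ))]
    [(Valued.v : Valuation K (WithZero (Multiplicative ℤ))).IsRankOneDiscrete] [CompleteSpace K]
    {P : Type v} [Group P] [Finite P]
    (hchar : ¬ ringChar (Valued.ResidueField K) ∣ Nat.card P)
    {L D : Type u} [Field L] [MulSemiringAction P L] [FaithfulSMul P L] [DivisionRing D]
    [Algebra K D] [FiniteDimensional K D] (φ : L →+* D)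
    (hC : ∀ x, (∀ a, x * φ a = φ a * x) → ∃ a, φ a = x) (y : P → D) (hy0 : ∀ g, y g ≠ 0)
    (hy : ∀ g a, y g * φ a = φ (g • a) * y g)
    (hd : ∀ d : D, ∀ a : L, (∀ g : P, g • a = a) → d * φ a = φ a * d) :
    ∃ (P₁ P₂ : Subgroup P) (_ : P₁.Normal) (_ : P₂.Normal),
      P₂ ≤ P₁ ∧ IsCyclic (P ⧸ P₁) ∧ IsCyclic P₂ ∧
        ∃ (E : Type u) (_ : Field E) (_ : Algebra (Valued.ResidueField K) E),
          FiniteDimensional (Valued.ResidueField K) E ∧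
            IsAdmissible E (P₁ ⧸ P₂.subgroupOf P₁) := by
  have := Fintype.ofFinite P
  obtain ⟨w, hw⟩ := exists_valuation_eq_norm K D
  have hwK : ∀ x : K, w (algebraMap K D x) =
      (Valued.v x : WithZero (Multiplicative ℤ)) ^ Module.finrank K D := fun x => by
    rw [hw, Algebra.norm_algebraMap, map_pow]
  have hpos : Module.finrank K D ≠ 0 := Module.finrank_pos.ne'
  have hwK_le : ∀ x : K, (Valued.v x : WithZero (Multiplicative ℤ)) ≤ 1 →
      w (algebraMap K D x) ≤ 1 := fun x hx => by
    rw [hwK]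
    exact pow_le_one' hx _
  have hunit : ∀ x : Valued.integer K, IsUnit x ↔
      (Valued.v (x : K) : WithZero (Multiplicative ℤ)) = 1 := fun x =>
    Valuation.Integers.isUnit_iff_valuation_eq_one (Valuation.integer.integers _)
  have hcard : w (Nat.card P : D) = 1 := by
    have h1 : (Nat.card P : Valued.ResidueField K) ≠ 0 := fun h =>
      hchar ((ringChar.spec _ _).mp h)
    rw [← map_natCast (IsLocalRing.residue (Valued.integer K)), IsLocalRing.residue_ne_zero_iff_isUnit,
      hunit] at h1
    rw [← map_natCast (algebraMap K D), hwK]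
    have h2 : (Valued.v (Nat.card P : K) : WithZero (Multiplicative ℤ)) = 1 := by
      simpa using h1
    rw [h2, one_pow]
  let C : ValuedCrossedProduct P L D :=
    { w := w, φ := φ, y := y, y_ne_zero := hy0, y_mul := hy
      exists_sum := fun d => exists_sum_mul φ hC y hy0 hy d (hd d)
      exists_of_commute := hC, w_card := hcard }
  obtain ⟨R, _, ⟨r⟩⟩ := C.w.exists_residueMap
  let E := Subring.center R
  let τ : Valued.integer K →+* R :=
    { toFun := fun x => r.res (algebraMap K D x)
      map_one' := by simp [r.res_one]
      map_zero' := by simp [r.res_zero]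
      map_mul' := fun a b => by
        rw [Subring.coe_mul, map_mul]
        exact r.res_mul (hwK_le _ a.2) (hwK_le _ b.2)
      map_add' := fun a b => by
        rw [Subring.coe_add, map_add]
        exact r.res_add (hwK_le _ a.2) (hwK_le _ b.2) }
  let σ : Valued.integer K →+* E := τ.codRestrict E (fun x => by
    rw [Subring.mem_center_iff]
    intro t
    obtain ⟨d, hd, rfl⟩ := r.exists_res t
    change r.res d * r.res (algebraMap K D x) = r.res (algebraMap K D x) * r.res d
    rw [← r.res_mul hd (hwK_le _ x.2), ← r.res_mul (hwK_le _ x.2) hd, Algebra.commutes])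
  -- Locality lets `σ` factor through the residue field, which makes `E` a `k`-algebra.
  have hσ : IsLocalHom σ := ⟨fun x hx => by
    have h1 : r.res (algebraMap K D x) ≠ 0 := fun h => hx.ne_zero (Subtype.ext h)
    have h2 : w (algebraMap K D x) = 1 := r.eq_one_of_res_ne_zero (hwK_le _ x.2) h1
    rw [hwK] at h2
    exact (hunit x).mpr (le_antisymm x.2 (not_lt.mp fun h =>
      (pow_lt_one₀ zero_le h hpos).ne h2))⟩
  let _ : Algebra (Valued.ResidueField K) E := (IsLocalRing.ResidueField.lift σ).toAlgebra
  have := C.isCyclic_unitInertia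
  refine ⟨C.valueHom.ker, C.unitInertia, inferInstance, inferInstance, inf_le_left,
    C.isCyclic_quotient_ker_valueHom, this, E, inferInstance, inferInstance, ?_,
    C.isAdmissible r⟩
  exact finiteDimensional_of_residueMap hwK_le r E.subtype
    (IsLocalRing.residue (Valued.integer K)) (fun x => rfl)

theorem proposition3p5 (K : Type u) [Field K] [Valued K (WithZero (Multiplicative ℤ))]
    [(Valued.v : Valuation K (WithZero (Multiplicative ℤ))).IsRankOneDiscrete] [CompleteSpace K]
    (G : Type v) [Group G] [Finite G]
    (hchar : ¬ ringChar (Valued.ResidueField K) ∣ Nat.card G)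
    (hG : IsAdmissible K G)
    (p : ℕ) [Fact p.Prime] (P : Sylow p G) :
    ∃ (P₁ P₂ : Subgroup P) (_ : P₁.Normal) (_ : P₂.Normal),
      P₂ ≤ P₁ ∧ IsCyclic (P ⧸ P₁) ∧ IsCyclic P₂ ∧
        ∃ (E : Type u) (_ : Field E) (_ : Algebra (Valued.ResidueField K) E),
          FiniteDimensional (Valued.ResidueField K) E ∧
            IsAdmissible E (P₁ ⧸ P₂.subgroupOf P₁) := by
  classical
  obtain ⟨L, _, _, _, ⟨e⟩, _, D, _, _, f, _, hmax⟩ := hG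
  have hC : ∀ x, (∀ a, x * f a = f a * x) → ∃ a, f a = x := fun x hx =>
    hmax.mem_of_commute (by
      rintro _ ⟨a, rfl⟩
      exact hx a)
  choose y hy0 hy using exists_ne_zero_mul_eq f
  -- Adequacy only makes `L` finite over `K`; the crossed product expansion bounds `D`.
  have hfin : FiniteDimensional K D := by
    let T : (Gal(L/K) → L) →ₗ[K] D :=
      { toFun := fun a => ∑ g, f (a g) * y g
        map_add' := fun a b => by simp [add_mul, Finset.sum_add_distrib]
        map_smul' := fun c a => by simp [Finset.smul_sum] }
    refine Module.Finite.of_surjective T fun d => ?_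
    obtain ⟨a, ha⟩ := exists_sum_mul (P := Gal(L/K)) (f : L →+* D) hC y hy0 hy d
      (fun a ha => by
        obtain ⟨k, rfl⟩ := (IsGalois.mem_bot_iff_fixed a).mpr ha
        have e : (f : L →+* D) (algebraMap K L k) = algebraMap K D k := f.commutes k
        exact e ▸ (Algebra.commutes k d).symm)
    exact ⟨a, ha.symm⟩
  let j : P →* Gal(L/K) := (e.symm : G →* Gal(L/K)).comp (P : Subgroup G).subtype
  have hj : Function.Injective j := e.symm.injective.comp Subtype.val_injective
  let _ : MulSemiringAction P L := MulSemiringAction.compHom L j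
  have hsmul : ∀ (g : P) (a : L), g • a = j g a := fun _ _ => rfl
  have : FaithfulSMul P L := ⟨fun h => hj (AlgEquiv.ext h)⟩
  -- `S` centralizes the fixed field of `P`. It contains `L`, and also `y (j g)` for `g ∈ P`, since
  -- `g` fixes that field: so `S` is the crossed product for `P`.
  let S : Subalgebra K D := Subalgebra.centralizer K (f '' {a | ∀ g : P, g • a = a})
  have hS : ∀ {x}, x ∈ S ↔ ∀ a : L, (∀ g : P, g • a = a) → f a * x = x * f a := by
    intro x
    rw [Subalgebra.mem_centralizer_iff]
    exact Set.forall_mem_image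
  let _ : DivisionRing S := DivisionRing.ofIsUnitOrEqZero (by
    intro x
    by_cases hx : (x : D) = 0
    · exact Or.inr (Subtype.ext hx)
    · exact Or.inl ⟨⟨x, ⟨_, Subalgebra.inv_mem_centralizer x.2⟩,
        Subtype.ext (mul_inv_cancel₀ hx), Subtype.ext (inv_mul_cancel₀ hx)⟩, rfl⟩)
  let φ : L →+* S := (f : L →+* D).codRestrict S fun a => hS.mpr fun b _ => by
    change f b * f a = f a * f b
    rw [← map_mul, ← map_mul, mul_comm]
  refine exists_normal_series_of_crossedProduct K
    (fun h => hchar (h.trans (Subgroup.card_subgroup_dvd_card _))) φ (fun x hx => ?_)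
    (fun g => ⟨y (j g), hS.mpr fun a ha => ?_⟩) (fun g h => hy0 (j g) (congrArg Subtype.val h))
    (fun g a => Subtype.ext (hy (j g) a)) (fun d a ha => Subtype.ext (hS.mp d.2 a ha).symm)
  · obtain ⟨a, ha⟩ := hC x fun a => congrArg Subtype.val (hx a)
    exact ⟨a, Subtype.ext ha⟩
  · rw [hy, ← hsmul, ha]
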